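/- Let $d\ge 1$ and $n\geq 1$, let $\otimes^d\mathbb{R}^n$ be the space of real $n\times\cdots\times n$ tensors $A=(a_{i_1\dots i_d})$ with the Frobenius inner product $\langle A,B\rangle_F=\sum a_{i_1\dots i_d}b_{i_1\dots i_d}$ and norm $\|A\|_F=\sqrt{\langle A,A\rangle_F}$, and let $\mathrm{Sym}^d(\mathbb{R}^n)$ be the subspace of tensors invariant under all permutations of the $d$ indices. A rank-one tensor is a nonzero tensor of the form $x^{(1)}\otimes\cdots\otimes x^{(d)}$. The spectral norm is $$\|A\|_2=\max_{\|x^{(1)}\|=\dots=\|x^{(d)}\|=1}\langle A,x^{(1)}\otimes\cdots\otimes x^{(d)}\rangle_F .$$ A best rank-one approximation of $A$ is a rank-one tensor $Y\in\otimes^d\mathbb{R}^n$ with $\|A-Y\|_F\le\|A-X\|_F$ for all rank-one $X\in\otimes^d\mathbb{R}^n$; it is called symmetric if $Y\in \mathrm{Sym}^d(\mathbb{R}^n)$. For a Lipschitz function $f$ on a finite-dimensional Euclidean space $E$, the generalized gradient $\partial f(p)$ is the convex hull of all limits $\lim_k\nabla f(p_k)$, where $p_k\to p$ and $f$ is differentiable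 at every $p_k$. For $E=\otimes^d\mathbb{R}^n$ or $E=\mathrm{Sym}^d(\mathbb{R}^n)$, both with the Frobenius inner product, a nonzero $A\in E$ is called critical in $E$ if, for $p=A/\|A\|_F$ and $f$ the spectral norm regarded as a function on $E$, one has $\mu p\in\partial f(p)$ for some $\mu\in\mathbb{R}$ (that is, $p$ is a critical point of the restriction of $f$ to the Frobenius unit sphere of $E$). **Theorem.** A nonzero tensor $A\in\mathrm{Sym}^d(\mathbb{R}^n)$ is critical in $\mathrm{Sym}^d(\mathbb{R}^n)$ if and only if the rescaled tensor $$\frac{\|A\|_2^2}{\|A\|_F^2}\,A$$ is a convex linear combination of (finitely many) symmetric best rank-one approximations of $A$. In this case $A$ is also critical in the full tensor space $\otimes^d\mathbb{R}^n$. -/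

import Mathlib

open Filter Topology

noncomputable section

/-- Real tensors of order `d` and format `n × ⋯ × n`, as tables of real numbers. The norm of this
Euclidean space is the Frobenius norm and its inner product is the Frobenius inner product. -/
abbrev RTensor (d n : ℕ) : Type := EuclideanSpace ℝ (Fin d → Fin n)

/-- The space of symmetric tensors: tables that are invariant under every permutation of the
`d` indices. -/
def symTensors (d n : ℕ) : Submodule ℝ (RTensor d n) where
  carrier := {A | ∀ (s : Equiv.Perm (Fin d)) (i : Fin d → Fin n), A (i ∘ s) = A i}
  add_mem' := by
    intro A B hA hB s i
    simp only [PiLp.add_apply, hA s i, hB s i]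
  zero_mem' := by
    intro s i
    simp
  smul_mem' := by
    intro c A hA s i
    simp only [PiLp.smul_apply, hA s i]

/-- The outer product of the vectors `x 0, …, x (d - 1)`. -/
def outerProduct {d n : ℕ} (x : Fin d → EuclideanSpace ℝ (Fin n)) : RTensor d n :=
  WithLp.toLp 2 fun i => ∏ j, x j (i j)

/-- Rank-one tensors: nonzero outer products. -/
def IsRankOne {d n : ℕ} (X : RTensor d n) : Prop :=
  X ≠ 0 ∧ ∃ x : Fin d → EuclideanSpace ℝ (Fin n), X = outerProduct x

/-- The spectral norm: the maximum of the Frobenius inner products of `A` with outer products of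
unit vectors. -/
def spectralNorm2 {d n : ℕ} (A : RTensor d n) : ℝ :=
  sSup {t : ℝ | ∃ x : Fin d → EuclideanSpace ℝ (Fin n),
    (∀ j, ‖x j‖ = 1) ∧ t = inner ℝ A (outerProduct x)}

/-- `Y` is a best rank-one approximation to `A`: a rank-one tensor which minimizes the Frobenius
distance to `A` among all (not necessarily symmetric) rank-one tensors. -/
def IsBestRankOneApprox {d n : ℕ} (A Y : RTensor d n) : Prop :=
  IsRankOne Y ∧ ∀ X : RTensor d n, IsRankOne X → ‖A - Y‖ ≤ ‖A - X‖

section Clarke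

variable {E : Type*} [NormedAddCommGroup E] [InnerProductSpace ℝ E] [CompleteSpace E]

/-- The generalized gradient of `f` at `p`: the convex hull of the set of all limits of
gradients `∇ f (u k)` along sequences of points of differentiability `u k` that converge to `p`. -/
def generalizedGradient (f : E → ℝ) (p : E) : Set E :=
  convexHull ℝ {g : E | ∃ u v : ℕ → E, (∀ k, HasGradientAt f (v k) (u k)) ∧
    Tendsto u atTop (𝓝 p) ∧ Tendsto v atTop (𝓝 g)}

/-- `p` is a critical point of the restriction of `f` to the unit sphere of `E`: the generalized
gradient of `f` (as a function on `E`) at `p` meets the normal space `{μ • p | μ ∈ ℝ}` of the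
sphere at `p`. -/
def IsCriticalOnUnitSphere (f : E → ℝ) (p : E) : Prop :=
  ‖p‖ = 1 ∧ ∃ μ : ℝ, μ • p ∈ generalizedGradient f p

end Clarke

/-- A nonzero tensor is critical (in the full tensor space) if its normalization is a critical
point of the restriction of the spectral norm to the Frobenius unit sphere. -/
def IsCriticalTensor {d n : ℕ} (A : RTensor d n) : Prop :=
  A ≠ 0 ∧ IsCriticalOnUnitSphere (fun B : RTensor d n => spectralNorm2 B) (‖A‖⁻¹ • A)

/-- A nonzero symmetric tensor is critical in the space of symmetric tensors if its normalization
is a critical point of the restriction of the spectral norm to the Frobenius unit sphere of that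
space; here the spectral norm is a function on the space of symmetric tensors only. -/
def IsCriticalSymTensor {d n : ℕ} (A : symTensors d n) : Prop :=
  A ≠ 0 ∧ IsCriticalOnUnitSphere
    (fun B : symTensors d n => spectralNorm2 (B : RTensor d n)) (‖A‖⁻¹ • A)

end

/-! The spectral norm is the support function of the compact set of outer products of unit vectors.
For any support function `f` of a compact set, the generalized gradient at `p` is the convex hull of
the maximizers of the pairing with `p` (`generalizedGradient_eq`). That hull lies in a hyperplane,
which determines the multiplier: `A` is critical iff `(f A / ‖A‖ ^ 2) • A` is in the hull of the
maximizers for `A`. Scaling by the spectral norm turns maximizers into best rank-one approximations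
(`isBestRankOneApprox_iff`).

The same argument runs inside the symmetric tensors because, by Banach's theorem
(`exists_symm_inner_eq_spectralNorm2`), the spectral norm there is the support function of the
symmetric unit outer products. Symmetric maximizers are maximizers, so criticality passes to the
full space. -/

/-! ### Generalized gradients of support functions. -/

section SupportFunction

variable {E : Type*} [NormedAddCommGroup E] [InnerProductSpace ℝ E]

/-- In finite dimension, the convex hull of a compact set is compact. -/
theorem isCompact_convexHull_of_finiteDimensional [FiniteDimensional ℝ E] {K : Set E}
    (hK : IsCompact K) : IsCompact (convexHull ℝ K) := by
  have h : convexHull ℝ K = ⋃ k ∈ Finset.range (Module.finrank ℝ E + 2),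
      (fun q : (Fin k → ℝ) × (Fin k → E) => ∑ i, q.1 i • q.2 i) ''
        (stdSimplex ℝ (Fin k) ×ˢ Set.univ.pi fun _ => K) := by
    apply Set.Subset.antisymm
    · intro x hx
      obtain ⟨ι, hι, z, w, hz, hind, hw, hw1, hx⟩ := eq_pos_convex_span_of_mem_convexHull hx
      simp only [Set.mem_iUnion, Set.mem_image]
      refine ⟨Fintype.card ι, ?_, (w ∘ (Fintype.equivFin ι).symm, z ∘ (Fintype.equivFin ι).symm),
        ⟨⟨fun i => (hw _).le, ?_⟩, fun i _ => hz ⟨_, rfl⟩⟩, ?_⟩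
      · have h1 := hind.card_le_finrank_succ
        have h2 := Submodule.finrank_le (vectorSpan ℝ (Set.range z))
        simp only [Finset.mem_range]
        omega
      · rw [← hw1]
        exact Equiv.sum_comp (Fintype.equivFin ι).symm w
      · rw [← hx]
        exact Equiv.sum_comp (Fintype.equivFin ι).symm fun i => w i • z i
    · refine Set.iUnion₂_subset fun k _ => ?_
      rintro _ ⟨q, ⟨hq, hz⟩, rfl⟩
      exact (convex_convexHull ℝ K).sum_mem (fun i _ => hq.1 i) hq.2
        fun i _ => subset_convexHull ℝ K (hz i trivial)
  rw [h]
  refine (Finset.range _).isCompact_biUnion fun k _ => ?_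
  refine ((isCompact_stdSimplex ℝ (Fin k)).prod (isCompact_univ_pi fun _ => hK)).image ?_
  fun_prop

/-- `f` is the support function of `K`, and the supremum is attained. -/
structure IsSupportFunction (K : Set E) (f : E → ℝ) : Prop where
  inner_le : ∀ A, ∀ X ∈ K, inner ℝ A X ≤ f A
  exists_eq : ∀ A, ∃ X ∈ K, inner ℝ A X = f A

/-- The points of `K` which maximize the inner product with `p`. -/
def exposedFace (K : Set E) (f : E → ℝ) (p : E) : Set E := {X | X ∈ K ∧ inner ℝ p X = f p}

namespace IsSupportFunction

variable {K : Set E} {f : E → ℝ}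

theorem lipschitzWith (hf : IsSupportFunction K f) (hK : IsCompact K) :
    ∃ C, LipschitzWith C f := by
  obtain ⟨R, hR⟩ := hK.isBounded.exists_norm_le
  refine ⟨R.toNNReal, LipschitzWith.of_le_add_mul' R fun A B => ?_⟩
  obtain ⟨X, hX, hAX⟩ := hf.exists_eq A
  have h1 := hf.inner_le B X hX
  have h2 : inner ℝ (A - B) X ≤ dist A B * R := by
    rw [dist_eq_norm]
    exact (real_inner_le_norm _ _).trans (mul_le_mul_of_nonneg_left (hR X hX) (norm_nonneg _))
  rw [inner_sub_left] at h2
  linarith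

/-- The function `f A - ⟪X, A⟫` is nonnegative and vanishes at `u`, so its gradient `v - X` is zero
there. -/
theorem eq_of_hasGradientAt [CompleteSpace E] (hf : IsSupportFunction K f) {u v X : E}
    (hv : HasGradientAt f v u) (hX : X ∈ exposedFace K f u) : X = v := by
  have hmin : IsLocalMin (fun A => f A - inner ℝ X A) u := by
    refine Filter.Eventually.of_forall fun A => ?_
    have h1 := hf.inner_le A X hX.1
    have h2 := hX.2
    simp only [real_inner_comm] at h1 h2 ⊢
    linarith
  have hd : HasFDerivAt (fun A => f A - inner ℝ X A)
      (InnerProductSpace.toDual ℝ E v - InnerProductSpace.toDual ℝ E X) u :=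
    hv.hasFDerivAt.sub (InnerProductSpace.toDual ℝ E X).hasFDerivAt
  exact ((InnerProductSpace.toDual ℝ E).injective (sub_eq_zero.1 (hmin.hasFDerivAt_eq_zero hd))).symm

theorem mem_exposedFace_of_hasGradientAt [CompleteSpace E] (hf : IsSupportFunction K f) {u v : E}
    (hv : HasGradientAt f v u) : v ∈ exposedFace K f u := by
  obtain ⟨X, hX⟩ := hf.exists_eq u
  exact hf.eq_of_hasGradientAt hv hX ▸ hX

/-- The set of limits of gradients which spans the generalized gradient. -/
def limitGradients [CompleteSpace E] (f : E → ℝ) (p : E) : Set E :=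
  {g : E | ∃ u v : ℕ → E, (∀ k, HasGradientAt f (v k) (u k)) ∧
    Tendsto u atTop (𝓝 p) ∧ Tendsto v atTop (𝓝 g)}

/-- It is a slice of the closure of the graph of the gradient. Closedness makes the set compact, as
needed for separation from its hull. -/
theorem isClosed_limitGradients [CompleteSpace E] (f : E → ℝ) (p : E) :
    IsClosed (limitGradients f p) := by
  have h : limitGradients f p =
      (fun g => (p, g)) ⁻¹' closure {q : E × E | HasGradientAt f q.2 q.1} := by
    ext g
    rw [Set.mem_preimage, mem_closure_iff_seq_limit]
    constructor
    · rintro ⟨u, v, h, hu, hv⟩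
      exact ⟨fun k => (u k, v k), h, hu.prodMk_nhds hv⟩
    · rintro ⟨q, h, hq⟩
      exact ⟨fun k => (q k).1, fun k => (q k).2, h, (continuous_fst.tendsto _).comp hq,
        (continuous_snd.tendsto _).comp hq⟩
  rw [h]
  exact isClosed_closure.preimage (by fun_prop)

theorem limitGradients_subset [CompleteSpace E] (hf : IsSupportFunction K f) (hK : IsCompact K)
    (p : E) : limitGradients f p ⊆ exposedFace K f p := by
  rintro g ⟨u, v, h, hu, hv⟩
  obtain ⟨C, hC⟩ := hf.lipschitzWith hK
  have hm := fun k => hf.mem_exposedFace_of_hasGradientAt (h k)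
  refine ⟨hK.isClosed.mem_of_tendsto hv (Filter.Eventually.of_forall fun k => (hm k).1), ?_⟩
  refine tendsto_nhds_unique (hu.inner hv) ?_
  simp only [fun k => (hm k).2]
  exact (hC.continuous.tendsto p).comp hu

/-- Rademacher's theorem. -/
theorem dense_differentiableAt [FiniteDimensional ℝ E] (hf : IsSupportFunction K f)
    (hK : IsCompact K) : Dense {u | DifferentiableAt ℝ f u} := by
  obtain ⟨C, hC⟩ := hf.lipschitzWith hK
  let _ : MeasurableSpace E := borel E
  have : BorelSpace E := ⟨rfl⟩
  exact MeasureTheory.Measure.dense_of_ae (hC.ae_differentiableAt (μ := MeasureTheory.Measure.addHaar))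

/-- Approach `p` from direction `v` through points of differentiability and take a limit of the
gradients: near `p`, on that side, the maximizers must pair with the direction at least as well as
`X` does. -/
theorem exists_limitGradients_inner_le [FiniteDimensional ℝ E] [CompleteSpace E]
    (hf : IsSupportFunction K f) (hK : IsCompact K) {p X : E} (hX : X ∈ exposedFace K f p) (v : E) :
    ∃ g ∈ limitGradients f p, inner ℝ v X ≤ inner ℝ v g := by
  have hex : ∀ t : ℝ, 0 < t → ∃ w : E, ‖w - v‖ < t ∧ DifferentiableAt ℝ f (p + t • w) := by
    intro t ht
    -- Precision `t * t` leaves an error below `t` in the direction after division by `t`.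
    obtain ⟨u, hu, hdist⟩ :=
      (hf.dense_differentiableAt hK).exists_dist_lt (p + t • v) (mul_pos ht ht)
    refine ⟨t⁻¹ • (u - p), ?_, ?_⟩
    · have h1 : t⁻¹ • (u - p) - v = t⁻¹ • (u - (p + t • v)) := by
        rw [← sub_sub, smul_sub t⁻¹ (u - p), smul_smul, inv_mul_cancel₀ ht.ne', one_smul]
      rw [h1, norm_smul, norm_inv, Real.norm_of_nonneg ht.le, ← dist_eq_norm, dist_comm,
        inv_mul_lt_iff₀ ht]
      exact hdist
    · rw [smul_smul, mul_inv_cancel₀ ht.ne', one_smul, add_sub_cancel]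
      exact hu
  set t : ℕ → ℝ := fun k => 1 / ((k : ℝ) + 1) with ht
  have htpos : ∀ k, 0 < t k := fun k => by positivity
  have ht0 : Tendsto t atTop (𝓝 0) := tendsto_one_div_add_atTop_nhds_zero_nat
  choose w hw hdiff using fun k => hex (t k) (htpos k)
  have hwv : Tendsto w atTop (𝓝 v) := by
    rw [tendsto_iff_norm_sub_tendsto_zero]
    exact squeeze_zero (fun _ => norm_nonneg _) (fun k => (hw k).le) ht0
  have hu : Tendsto (fun k => p + t k • w k) atTop (𝓝 p) := by
    simpa using tendsto_const_nhds.add (ht0.smul hwv)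
  have hm := fun k => hf.mem_exposedFace_of_hasGradientAt (hdiff k).hasGradientAt
  obtain ⟨g, -, φ, hφ, hg⟩ := hK.tendsto_subseq fun k => (hm k).1
  refine ⟨g, ⟨_, _, fun k => (hdiff (φ k)).hasGradientAt, hu.comp hφ.tendsto_atTop, hg⟩, ?_⟩
  have hwφ := hwv.comp hφ.tendsto_atTop
  refine le_of_tendsto_of_tendsto' (hwφ.inner tendsto_const_nhds) (hwφ.inner hg) fun k => ?_
  -- The gradient beats `X` at the perturbed point but not at `p`; the difference is `t` times the
  -- claim.
  have h1 := hf.inner_le (p + t (φ k) • w (φ k)) X hX.1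
  rw [← (hm (φ k)).2, inner_add_left, inner_add_left, hX.2, inner_smul_left, inner_smul_left] at h1
  have h2 := hf.inner_le p _ (hm (φ k)).1
  simp only [conj_trivial] at h1
  refine le_of_mul_le_mul_left ?_ (htpos (φ k))
  simp only [Function.comp_apply]
  linarith

/-- The generalized gradient of the support function of a compact set at `p` is the convex hull of
the face exposed by `p`. -/
theorem generalizedGradient_eq [FiniteDimensional ℝ E] [CompleteSpace E]
    (hf : IsSupportFunction K f) (hK : IsCompact K) (p : E) :
    generalizedGradient f p = convexHull ℝ (exposedFace K f p) := by
  have hsub := hf.limitGradients_subset hK p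
  refine Set.Subset.antisymm (convexHull_mono hsub)
    (convexHull_min (fun X hX => ?_) (convex_convexHull ℝ _))
  have hcomp : IsCompact (limitGradients f p) :=
    hK.of_isClosed_subset (isClosed_limitGradients f p) (hsub.trans fun _ h => h.1)
  by_contra hXn
  -- The Riesz vector of the separating functional is the direction of approach that gives a
  -- contradiction.
  obtain ⟨l, c, hlt, hc⟩ := geometric_hahn_banach_closed_point (convex_convexHull ℝ _)
    (isCompact_convexHull_of_finiteDimensional hcomp).isClosed hXn
  obtain ⟨g, hg, hle⟩ := hf.exists_limitGradients_inner_le hK hX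
    ((InnerProductSpace.toDual ℝ E).symm l)
  simp only [InnerProductSpace.toDual_symm_apply] at hle
  exact absurd (hlt g (subset_convexHull ℝ _ hg)) (by linarith)

/-- If a multiple `μ • p` of the unit vector `p` lies in the face exposed by `p`, then `μ = f p`. -/
theorem isCriticalOnUnitSphere_iff [FiniteDimensional ℝ E] [CompleteSpace E]
    (hf : IsSupportFunction K f) (hK : IsCompact K) {p : E} (hp : ‖p‖ = 1) :
    IsCriticalOnUnitSphere f p ↔ f p • p ∈ convexHull ℝ (exposedFace K f p) := by
  rw [IsCriticalOnUnitSphere, hf.generalizedGradient_eq hK]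
  refine ⟨?_, fun h => ⟨hp, _, h⟩⟩
  rintro ⟨-, μ, hμ⟩
  have hconv : Convex ℝ {X : E | inner ℝ p X = f p} :=
    convex_hyperplane (innerSL ℝ p).toLinearMap.isLinear _
  have h : inner ℝ p (μ • p) = f p := convexHull_min (fun X hX => hX.2) hconv hμ
  rw [inner_smul_right, real_inner_self_eq_norm_sq, hp, one_pow, mul_one] at h
  exact h ▸ hμ

theorem apply_smul (hf : IsSupportFunction K f) {c : ℝ} (hc : 0 ≤ c) (A : E) :
    f (c • A) = c * f A := by
  obtain ⟨X, hX, hAX⟩ := hf.exists_eq A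
  obtain ⟨Y, hY, hAY⟩ := hf.exists_eq (c • A)
  have h1 := hf.inner_le (c • A) X hX
  have h2 := mul_le_mul_of_nonneg_left (hf.inner_le A Y hY) hc
  rw [inner_smul_left, conj_trivial] at h1 hAY
  rw [hAX] at h1
  linarith

theorem exposedFace_smul (hf : IsSupportFunction K f) {c : ℝ} (hc : 0 < c) (A : E) :
    exposedFace K f (c • A) = exposedFace K f A := by
  ext X
  simp only [exposedFace, Set.mem_ofPred_eq, hf.apply_smul hc.le, inner_smul_left, conj_trivial,
    mul_right_inj' hc.ne']

/-- Criticality of the normalization of `A`, expressed through `A` itself. -/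
theorem isCriticalOnUnitSphere_normalize_iff [FiniteDimensional ℝ E] [CompleteSpace E]
    (hf : IsSupportFunction K f) (hK : IsCompact K) {A : E} (hA : A ≠ 0) :
    IsCriticalOnUnitSphere f (‖A‖⁻¹ • A) ↔
      (f A / ‖A‖ ^ 2) • A ∈ convexHull ℝ (exposedFace K f A) := by
  have hpos : 0 < ‖A‖⁻¹ := inv_pos.2 (norm_pos_iff.2 hA)
  have hnorm : ‖‖A‖⁻¹ • A‖ = 1 := norm_smul_inv_norm (𝕜 := ℝ) hA
  rw [hf.isCriticalOnUnitSphere_iff hK hnorm, hf.exposedFace_smul hpos,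
    hf.apply_smul hpos.le, smul_smul]
  congr! 2
  ring

end IsSupportFunction

end SupportFunction
-- Outer products and the spectral norm.
section OuterProduct

variable {d n : ℕ}

theorem outerProduct_apply (x : Fin d → EuclideanSpace ℝ (Fin n)) (i : Fin d → Fin n) :
    outerProduct x i = ∏ j, x j (i j) := rfl

/-- The outer product as a multilinear map. -/
def outerProductMultilinear (d n : ℕ) :
    MultilinearMap ℝ (fun _ : Fin d => EuclideanSpace ℝ (Fin n)) (RTensor d n) where
  toFun := outerProduct
  map_update_add' {dec} x j u v := by
    obtain rfl : dec = instDecidableEqFin d := Subsingleton.elim _ _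
    ext i
    simp only [PiLp.add_apply, outerProduct_apply]
    rw [← Finset.mul_prod_erase _ _ (Finset.mem_univ j),
      ← Finset.mul_prod_erase _ _ (Finset.mem_univ j),
      ← Finset.mul_prod_erase _ _ (Finset.mem_univ j)]
    have h : ∀ w, ∏ k ∈ Finset.univ.erase j, Function.update x j w k (i k) =
        ∏ k ∈ Finset.univ.erase j, x k (i k) := fun w =>
      Finset.prod_congr rfl fun k hk => by rw [Function.update_of_ne (Finset.ne_of_mem_erase hk)]
    simp only [h, Function.update_self, PiLp.add_apply, add_mul]
  map_update_smul' {dec} x j c u := by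
    obtain rfl : dec = instDecidableEqFin d := Subsingleton.elim _ _
    ext i
    simp only [PiLp.smul_apply, outerProduct_apply]
    rw [← Finset.mul_prod_erase _ _ (Finset.mem_univ j),
      ← Finset.mul_prod_erase _ _ (Finset.mem_univ j)]
    have h : ∀ w, ∏ k ∈ Finset.univ.erase j, Function.update x j w k (i k) =
        ∏ k ∈ Finset.univ.erase j, x k (i k) := fun w =>
      Finset.prod_congr rfl fun k hk => by rw [Function.update_of_ne (Finset.ne_of_mem_erase hk)]
    simp only [h, Function.update_self, PiLp.smul_apply, smul_eq_mul, mul_assoc]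

theorem outerProductMultilinear_apply (x : Fin d → EuclideanSpace ℝ (Fin n)) :
    outerProductMultilinear d n x = outerProduct x := rfl

/-- After squaring, expanding the product of coordinate sums gives the sum over multi-indices. -/
theorem norm_outerProduct (x : Fin d → EuclideanSpace ℝ (Fin n)) :
    ‖outerProduct x‖ = ∏ j, ‖x j‖ := by
  refine (sq_eq_sq₀ (norm_nonneg _) (Finset.prod_nonneg fun _ _ => norm_nonneg _)).1 ?_
  simp only [← Finset.prod_pow, EuclideanSpace.norm_sq_eq, outerProduct_apply, norm_prod]
  rw [Finset.prod_univ_sum, Fintype.piFinset_univ]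

theorem continuous_outerProduct :
    Continuous (outerProduct : (Fin d → EuclideanSpace ℝ (Fin n)) → RTensor d n) := by
  unfold outerProduct
  fun_prop

/-- Outer products of unit vectors. -/
def unitOuterProducts (d n : ℕ) : Set (RTensor d n) :=
  outerProduct '' {x | ∀ j, ‖x j‖ = 1}

theorem isCompact_setOf_norm_eq_one :
    IsCompact {x : Fin d → EuclideanSpace ℝ (Fin n) | ∀ j, ‖x j‖ = 1} := by
  have h : {x : Fin d → EuclideanSpace ℝ (Fin n) | ∀ j, ‖x j‖ = 1} =
      Set.univ.pi fun _ => Metric.sphere 0 1 := by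
    ext x
    simp
  rw [h]
  exact isCompact_univ_pi fun _ => isCompact_sphere 0 1

theorem isCompact_unitOuterProducts : IsCompact (unitOuterProducts d n) :=
  isCompact_setOf_norm_eq_one.image continuous_outerProduct

theorem norm_eq_one_of_mem_unitOuterProducts {X : RTensor d n} (hX : X ∈ unitOuterProducts d n) :
    ‖X‖ = 1 := by
  obtain ⟨x, hx, rfl⟩ := hX
  rw [norm_outerProduct]
  exact Finset.prod_eq_one fun j _ => hx j

theorem outerProduct_single (i : Fin d → Fin n) :
    outerProduct (fun j => EuclideanSpace.single (i j) (1 : ℝ)) = EuclideanSpace.single i 1 := by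
  ext k
  simp only [outerProduct_apply, PiLp.single_apply, Finset.prod_boole, funext_iff,
    Finset.mem_univ, true_imp_iff]

theorem single_mem_unitOuterProducts (i : Fin d → Fin n) :
    EuclideanSpace.single i (1 : ℝ) ∈ unitOuterProducts d n :=
  ⟨_, fun j => by simp, outerProduct_single i⟩

theorem neg_mem_unitOuterProducts (hd : 1 ≤ d) {X : RTensor d n}
    (hX : X ∈ unitOuterProducts d n) : -X ∈ unitOuterProducts d n := by
  obtain ⟨x, hx, rfl⟩ := hX
  refine ⟨Function.update x ⟨0, hd⟩ (-x ⟨0, hd⟩), fun j => ?_, ?_⟩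
  · rcases eq_or_ne j ⟨0, hd⟩ with rfl | hj
    · simpa using hx ⟨0, hd⟩
    · rw [Function.update_of_ne hj, hx]
  · rw [← outerProductMultilinear_apply, MultilinearMap.map_update_neg, Function.update_eq_self,
      outerProductMultilinear_apply]

/-- The spectral norm is the support function of the set of outer products of unit vectors. -/
theorem isSupportFunction_spectralNorm2 (hn : (unitOuterProducts d n).Nonempty) :
    IsSupportFunction (unitOuterProducts d n) spectralNorm2 := by
  have h : ∀ A : RTensor d n,
      IsGreatest ((fun X => inner ℝ A X) '' unitOuterProducts d n) (spectralNorm2 A) := by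
    intro A
    have hset : {t : ℝ | ∃ x : Fin d → EuclideanSpace ℝ (Fin n),
        (∀ j, ‖x j‖ = 1) ∧ t = inner ℝ A (outerProduct x)} =
        (fun X => inner ℝ A X) '' unitOuterProducts d n := by
      ext t
      simp [unitOuterProducts, eq_comm]
    obtain ⟨t, ht⟩ := (isCompact_unitOuterProducts.image
      (f := fun X : RTensor d n => inner ℝ A X) (by fun_prop)).exists_isGreatest (hn.image _)
    rw [spectralNorm2, hset, ht.csSup_eq]
    exact ht
  exact ⟨fun A X hX => (h A).2 ⟨X, hX, rfl⟩, fun A => (h A).1⟩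

theorem abs_inner_le_spectralNorm2 (hd : 1 ≤ d) (A : RTensor d n) {X : RTensor d n}
    (hX : X ∈ unitOuterProducts d n) : |inner ℝ A X| ≤ spectralNorm2 A := by
  have hf := isSupportFunction_spectralNorm2 ⟨X, hX⟩
  have h := hf.inner_le A _ (neg_mem_unitOuterProducts hd hX)
  rw [inner_neg_right] at h
  exact abs_le'.2 ⟨hf.inner_le A X hX, h⟩

/-- Standard basis tensors are unit outer products, so the spectral norm dominates every entry. -/
theorem spectralNorm2_pos (hd : 1 ≤ d) {A : RTensor d n} (hA : A ≠ 0) : 0 < spectralNorm2 A := by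
  obtain ⟨i, hi⟩ : ∃ i, A i ≠ 0 := by
    by_contra! h
    exact hA (by ext i; exact h i)
  have h := abs_inner_le_spectralNorm2 hd A (single_mem_unitOuterProducts i)
  rw [EuclideanSpace.inner_single_right] at h
  refine lt_of_lt_of_le (abs_pos.2 ?_) h
  simpa using hi

theorem unitOuterProducts_nonempty {A : RTensor d n} (hA : A ≠ 0) :
    (unitOuterProducts d n).Nonempty := by
  obtain ⟨i, hi⟩ : ∃ i, A i ≠ 0 := by
    by_contra! h
    exact hA (by ext i; exact h i)
  exact ⟨_, single_mem_unitOuterProducts i⟩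

end OuterProduct

/-! ### Banach's theorem on symmetric maximizers. -/

section Banach

variable {d n : ℕ}

theorem inner_outerProduct_comp_perm {A : RTensor d n} (hA : A ∈ symTensors d n)
    (x : Fin d → EuclideanSpace ℝ (Fin n)) (s : Equiv.Perm (Fin d)) :
    inner ℝ A (outerProduct (x ∘ s)) = inner ℝ A (outerProduct x) := by
  simp only [PiLp.inner_apply]
  refine Fintype.sum_equiv (s.arrowCongr (Equiv.refl (Fin n))) _ _ fun i => ?_
  have h1 : A (s.arrowCongr (Equiv.refl (Fin n)) i) = A i := hA s.symm i
  have h2 : outerProduct x (s.arrowCongr (Equiv.refl (Fin n)) i) = outerProduct (x ∘ s) i := by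
    rw [outerProduct_apply, outerProduct_apply]
    refine (Fintype.prod_equiv s _ _ fun j => ?_).symm
    rw [Equiv.arrowCongr_apply]
    simp
  rw [h1, h2]

theorem outerProduct_const_mem_symTensors (u : EuclideanSpace ℝ (Fin n)) :
    outerProduct (fun _ : Fin d => u) ∈ symTensors d n := fun s i =>
  Fintype.prod_equiv s (fun j => u (i (s j))) (fun j => u (i j)) fun _ => rfl

theorem exists_norm_eq_one_eq_smul {E : Type*} [NormedAddCommGroup E] [NormedSpace ℝ E] {u : E}
    (hu : ‖u‖ = 1) (w : E) : ∃ z : E, ‖z‖ = 1 ∧ w = ‖w‖ • z := by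
  rcases eq_or_ne w 0 with rfl | hw
  · exact ⟨u, hu, by simp⟩
  · exact ⟨‖w‖⁻¹ • w, norm_smul_inv_norm (𝕜 := ℝ) hw,
      by rw [smul_smul, mul_inv_cancel₀ (norm_ne_zero_iff.2 hw), one_smul]⟩

/-- If a symmetric tensor attains its spectral norm at a tuple of unit vectors with entries `u`, `v`
in two positions, then it also attains it with the normalization of `u + v` in both positions. -/
theorem exists_abs_inner_outerProduct_update (hd : 1 ≤ d) {A : RTensor d n}
    (hA : A ∈ symTensors d n) {x : Fin d → EuclideanSpace ℝ (Fin n)} (hx : ∀ j, ‖x j‖ = 1)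
    (hmax : |inner ℝ A (outerProduct x)| = spectralNorm2 A) {i j : Fin d} (hij : i ≠ j) :
    ∃ z : EuclideanSpace ℝ (Fin n), ‖z‖ = 1 ∧ x i + x j = ‖x i + x j‖ • z ∧
      ∀ ε : ℝ, |ε| = 1 → |inner ℝ A (outerProduct
        (Function.update (Function.update x i (ε • z)) j (ε • z)))| = spectralNorm2 A := by
  -- Fixing the other factors leaves a symmetric bilinear form.
  set b : EuclideanSpace ℝ (Fin n) → EuclideanSpace ℝ (Fin n) → ℝ := fun u v =>
    inner ℝ A (outerProduct (Function.update (Function.update x i u) j v)) with hb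
  have badd : ∀ u v w, b u (v + w) = b u v + b u w := fun u v w => by
    simp only [hb, ← outerProductMultilinear_apply, MultilinearMap.map_update_add, inner_add_right]
  have bsmul : ∀ u v (c : ℝ), b u (c • v) = c * b u v := fun u v c => by
    simp only [hb, ← outerProductMultilinear_apply, MultilinearMap.map_update_smul,
      inner_smul_right]
  have bsymm : ∀ u v, b u v = b v u := fun u v => by
    simp only [hb]
    rw [← inner_outerProduct_comp_perm hA _ (Equiv.swap i j)]
    congr 2
    funext k
    rcases eq_or_ne k i with rfl | hki
    · simp [hij]
    rcases eq_or_ne k j with rfl | hkj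
    · simp [hij]
    · simp [Equiv.swap_apply_of_ne_of_ne hki hkj, hki, hkj]
  have bxx : b (x i) (x j) = inner ℝ A (outerProduct x) := by
    simp only [hb, Function.update_eq_self]
  have ble : ∀ z, ‖z‖ = 1 → |b z z| ≤ spectralNorm2 A := fun z hz => by
    refine abs_inner_le_spectralNorm2 hd A ⟨_, fun k => ?_, rfl⟩
    rcases eq_or_ne k j with rfl | hkj
    · simp [hz]
    rcases eq_or_ne k i with rfl | hki
    · simp [hz, hkj]
    · simp [hki, hkj, hx]
  have hsign : ∀ z, |b z z| = spectralNorm2 A →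
      ∀ ε : ℝ, |ε| = 1 → |b (ε • z) (ε • z)| = spectralNorm2 A := fun z hz ε hε => by
    rw [bsmul, bsymm, bsmul, abs_mul, abs_mul, hε, one_mul, one_mul, hz]
  rcases eq_or_ne (x i + x j) 0 with h0 | h0
  · refine ⟨x i, hx i, by simp [h0], hsign _ ?_⟩
    have h1 : x j = (-1 : ℝ) • x i := by
      rw [neg_one_smul]
      exact (neg_eq_of_add_eq_zero_right h0).symm
    rw [← bxx, h1, bsmul] at hmax
    simpa using hmax
  · obtain ⟨z, hz, hzr⟩ := exists_norm_eq_one_eq_smul (hx i) (x i + x j)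
    obtain ⟨y, hy, hys⟩ := exists_norm_eq_one_eq_smul (hx i) (x i - x j)
    refine ⟨z, hz, hzr, hsign z (le_antisymm (ble z hz) ?_)⟩
    have hpar := parallelogram_law_with_norm ℝ (x i) (x j)
    rw [hx, hx] at hpar
    have hr : 0 < ‖x i + x j‖ := norm_pos_iff.2 h0
    -- Polarization: since the squared norms of sum and difference add up to 4, the bound on the
    -- diagonal values of `b` forces equality at `z`.
    have hpol : 4 * b (x i) (x j) =
        b (x i + x j) (x i + x j) - b (x i - x j) (x i - x j) := by
      have h1 : x i - x j = x i + (-1 : ℝ) • x j := by rw [neg_one_smul, sub_eq_add_neg]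
      have h2 : ∀ u v w, b (u + v) w = b u w + b v w := fun u v w => by
        rw [bsymm, badd, bsymm w, bsymm w]
      have h3 : ∀ u v (c : ℝ), b (c • u) v = c * b u v := fun u v c => by
        rw [bsymm, bsmul, bsymm v]
      rw [h1]
      simp only [badd, h2, bsmul, h3, bsymm (x j) (x i)]
      ring
    have hzz : b (x i + x j) (x i + x j) = ‖x i + x j‖ ^ 2 * b z z := by
      conv_lhs => rw [hzr, bsmul, bsymm, bsmul]
      ring
    have hyy : b (x i - x j) (x i - x j) = ‖x i - x j‖ ^ 2 * b y y := by
      conv_lhs => rw [hys, bsmul, bsymm, bsmul]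
      ring
    have habs : 4 * spectralNorm2 A ≤
        ‖x i + x j‖ ^ 2 * |b z z| + ‖x i - x j‖ ^ 2 * |b y y| := by
      have h1 := abs_sub (‖x i + x j‖ ^ 2 * b z z) (‖x i - x j‖ ^ 2 * b y y)
      rw [← hzz, ← hyy, ← hpol, hzz, hyy, abs_mul, abs_mul, abs_mul, bxx, hmax,
        abs_of_nonneg (sq_nonneg ‖x i + x j‖), abs_of_nonneg (sq_nonneg ‖x i - x j‖),
        abs_of_nonneg (by norm_num : (0 : ℝ) ≤ 4)] at h1
      exact h1
    have hyle := mul_le_mul_of_nonneg_left (ble y hy) (sq_nonneg ‖x i - x j‖)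
    refine le_of_mul_le_mul_left ?_ (pow_pos hr 2)
    have hfour : ‖x i - x j‖ ^ 2 = 4 - ‖x i + x j‖ ^ 2 := by linarith
    have h1 := habs.trans (add_le_add_right hyle _)
    rw [hfour] at h1
    linarith

/-- **Banach's theorem**: the spectral norm of a symmetric tensor is attained at a symmetric outer
product of unit vectors. -/
theorem exists_symm_inner_eq_spectralNorm2 (hd : 1 ≤ d) (hn : (unitOuterProducts d n).Nonempty)
    {A : RTensor d n} (hA : A ∈ symTensors d n) :
    ∃ X ∈ unitOuterProducts d n, X ∈ symTensors d n ∧ inner ℝ A X = spectralNorm2 A := by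
  set M : Set (Fin d → EuclideanSpace ℝ (Fin n)) :=
    {x | (∀ j, ‖x j‖ = 1) ∧ |inner ℝ A (outerProduct x)| = spectralNorm2 A} with hM
  have hMc : IsCompact M := by
    refine isCompact_setOf_norm_eq_one.inter_right (isClosed_eq ?_ continuous_const)
    exact (continuous_const.inner continuous_outerProduct).abs
  have hMn : M.Nonempty := by
    obtain ⟨X, ⟨x, hx, rfl⟩, hX⟩ := (isSupportFunction_spectralNorm2 hn).exists_eq A
    refine ⟨x, hx, le_antisymm (abs_inner_le_spectralNorm2 hd A ⟨x, hx, rfl⟩) ?_⟩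
    rw [← hX]
    exact le_abs_self _
  -- Among the maximizing tuples, take one whose sum is longest. If two entries differed, replacing
  -- both by `z` or both by `-z` would lengthen the sum.
  obtain ⟨x, ⟨hx, hxA⟩, hmax⟩ :=
    hMc.exists_isMaxOn (f := fun x => ‖∑ j, x j‖ ^ 2) hMn (by fun_prop)
  have hconst : ∀ i j, x i = x j := by
    intro i j
    by_contra hne
    have hij : i ≠ j := fun h => hne (h ▸ rfl)
    obtain ⟨z, hz, hr, hzA⟩ := exists_abs_inner_outerProduct_update hd hA hx hxA hij
    set r := ‖x i + x j‖ with hrdef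
    set w := ∑ k, x k - r • z with hw
    have hle : ∀ ε : ℝ, |ε| = 1 → ‖w + (2 * ε) • z‖ ^ 2 ≤ ‖w + r • z‖ ^ 2 := by
      intro ε hε
      have hmem : Function.update (Function.update x i (ε • z)) j (ε • z) ∈ M := by
        refine ⟨fun k => ?_, hzA ε hε⟩
        have h1 : ‖ε • z‖ = 1 := by rw [norm_smul, hz, mul_one, Real.norm_eq_abs, hε]
        rcases eq_or_ne k j with rfl | hkj
        · simp [h1]
        rcases eq_or_ne k i with rfl | hki
        · simp [h1, hkj]
        · simp [hki, hkj, hx]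
      have hsum : ∑ k, Function.update (Function.update x i (ε • z)) j (ε • z) k =
          w + (2 * ε) • z := by
        have h1 : ∑ k, (Function.update (Function.update x i (ε • z)) j (ε • z) k - x k) =
            (ε • z - x i) + (ε • z - x j) := by
          rw [Fintype.sum_eq_add i j hij]
          · simp [hij]
          · rintro k ⟨hki, hkj⟩
            simp [hki, hkj]
        rw [Finset.sum_sub_distrib, sub_eq_iff_eq_add] at h1
        rw [h1, hw, ← hr]
        module
      have h2 := hmax hmem
      simp only [Set.mem_ofPred_eq, hsum] at h2
      rwa [hw, sub_add_cancel]
    have hr2 : r < 2 := by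
      have h1 := parallelogram_law_with_norm ℝ (x i) (x j)
      rw [hx, hx, ← hrdef] at h1
      have h2 : 0 < ‖x i - x j‖ := norm_pos_iff.2 (sub_ne_zero.2 hne)
      nlinarith
    have hexp : ∀ c : ℝ, ‖w + c • z‖ ^ 2 = ‖w‖ ^ 2 + 2 * (c * inner ℝ w z) + c ^ 2 := by
      intro c
      rw [norm_add_sq_real, inner_smul_right, norm_smul, hz, mul_one, Real.norm_eq_abs, sq_abs]
    have h1 := hle 1 (by norm_num)
    have h2 := hle (-1) (by norm_num)
    rw [hexp, hexp] at h1 h2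
    have hr0 : 0 ≤ r := norm_nonneg _
    -- For `ε = 1` the bound factors as `(2 - r) * (2 * ⟪w, z⟫ + 2 + r) ≤ 0`, so `⟪w, z⟫ < 0`; for
    -- `ε = -1` it would need `2 * ⟪w, z⟫ ≥ 2 - r > 0`.
    have h3 : 2 * inner ℝ w z + 2 + r ≤ 0 := by
      by_contra! h
      nlinarith [mul_pos (sub_pos.2 hr2) h]
    nlinarith [mul_nonneg hr0 (by linarith : 0 ≤ -inner ℝ w z)]
  have hsymm : outerProduct x ∈ symTensors d n := by
    have h1 : x = fun _ => x ⟨0, hd⟩ := funext fun j => hconst j _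
    rw [h1]
    exact outerProduct_const_mem_symTensors _
  have hxC : outerProduct x ∈ unitOuterProducts d n := ⟨x, hx, rfl⟩
  -- Only the absolute value was maximized; negating the tensor restores the sign.
  rcases abs_choice (inner ℝ A (outerProduct x)) with h | h
  · exact ⟨_, hxC, hsymm, h ▸ hxA⟩
  · refine ⟨_, neg_mem_unitOuterProducts hd hxC, Submodule.neg_mem _ hsymm, ?_⟩
    rw [inner_neg_right, ← h, hxA]

end Banach

/-! ### Best rank-one approximations as scaled maximizers. -/

section BestApproximation

variable {d n : ℕ}

theorem isRankOne_iff (hd : 1 ≤ d) (X : RTensor d n) :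
    IsRankOne X ↔ ∃ t : ℝ, 0 < t ∧ ∃ Z ∈ unitOuterProducts d n, X = t • Z := by
  constructor
  · rintro ⟨hX, x, rfl⟩
    have hprod : 0 < ∏ j, ‖x j‖ := by
      rw [← norm_outerProduct]
      exact norm_pos_iff.2 hX
    have hx : ∀ j, ‖x j‖ ≠ 0 := fun j => Finset.prod_ne_zero_iff.1 hprod.ne' j (Finset.mem_univ j)
    refine ⟨_, hprod, _, ⟨fun j => ‖x j‖⁻¹ • x j, fun j => ?_, rfl⟩, ?_⟩
    · exact norm_smul_inv_norm (𝕜 := ℝ) (norm_ne_zero_iff.1 (hx j))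
    · rw [← outerProductMultilinear_apply, ← outerProductMultilinear_apply,
        ← MultilinearMap.map_smul_univ]
      congr 1
      funext j
      rw [smul_smul, mul_inv_cancel₀ (hx j), one_smul]
  · rintro ⟨t, ht, Z, hZ, rfl⟩
    refine ⟨smul_ne_zero ht.ne' fun h => ?_, ?_⟩
    · have h1 := norm_eq_one_of_mem_unitOuterProducts hZ
      rw [h, norm_zero] at h1
      exact zero_ne_one h1
    · obtain ⟨x, -, rfl⟩ := hZ
      refine ⟨Function.update x ⟨0, hd⟩ (t • x ⟨0, hd⟩), ?_⟩
      rw [← outerProductMultilinear_apply, ← outerProductMultilinear_apply,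
        MultilinearMap.map_update_smul, Function.update_eq_self]

theorem norm_sub_smul_sq_of_mem_unitOuterProducts (A : RTensor d n) {Z : RTensor d n}
    (hZ : Z ∈ unitOuterProducts d n) (t : ℝ) :
    ‖A - t • Z‖ ^ 2 = ‖A‖ ^ 2 - 2 * (t * inner ℝ A Z) + t ^ 2 := by
  rw [norm_sub_sq_real, inner_smul_right, norm_smul, norm_eq_one_of_mem_unitOuterProducts hZ,
    mul_one, Real.norm_eq_abs, sq_abs]

/-- The best rank-one approximations of `A ≠ 0` are the products of the spectral norm with the
maximizers in its definition. -/
theorem isBestRankOneApprox_iff (hd : 1 ≤ d) {A : RTensor d n} (hA : A ≠ 0) (Y : RTensor d n) :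
    IsBestRankOneApprox A Y ↔
      ∃ X ∈ exposedFace (unitOuterProducts d n) spectralNorm2 A, Y = spectralNorm2 A • X := by
  have hf := isSupportFunction_spectralNorm2 (unitOuterProducts_nonempty hA)
  have hpos := spectralNorm2_pos hd hA
  constructor
  · rintro ⟨hY, hbest⟩
    obtain ⟨t, ht, Z, hZ, rfl⟩ := (isRankOne_iff hd Y).1 hY
    obtain ⟨X, hX, hAX⟩ := hf.exists_eq A
    have h1 := pow_le_pow_left₀ (norm_nonneg _)
      (hbest _ ((isRankOne_iff hd _).2 ⟨_, hpos, X, hX, rfl⟩)) 2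
    rw [norm_sub_smul_sq_of_mem_unitOuterProducts A hZ,
      norm_sub_smul_sq_of_mem_unitOuterProducts A hX, hAX] at h1
    have h2 := hf.inner_le A Z hZ
    have h3 := mul_nonneg ht.le (sub_nonneg.2 h2)
    -- Comparison with the competitor `spectralNorm2 A • X`, together with `h3`, gives `(t -
    -- spectralNorm2 A) ^ 2 ≤ 0`.
    have h4 : t = spectralNorm2 A :=
      sub_eq_zero.1 (pow_eq_zero_iff two_ne_zero |>.1 (by nlinarith))
    have h5 : inner ℝ A Z = spectralNorm2 A := by
      refine le_antisymm h2 (le_of_mul_le_mul_left ?_ ht)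
      nlinarith [sq_nonneg (t - spectralNorm2 A)]
    exact ⟨Z, ⟨hZ, h5⟩, by rw [h4]⟩
  · rintro ⟨X, ⟨hX, hAX⟩, rfl⟩
    refine ⟨(isRankOne_iff hd _).2 ⟨_, hpos, X, hX, rfl⟩, fun W hW => ?_⟩
    obtain ⟨t, ht, Z, hZ, rfl⟩ := (isRankOne_iff hd W).1 hW
    refine (sq_le_sq₀ (norm_nonneg _) (norm_nonneg _)).1 ?_
    rw [norm_sub_smul_sq_of_mem_unitOuterProducts A hZ,
      norm_sub_smul_sq_of_mem_unitOuterProducts A hX, hAX]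
    have h2 := mul_le_mul_of_nonneg_left (hf.inner_le A Z hZ) ht.le
    nlinarith [sq_nonneg (t - spectralNorm2 A)]

end BestApproximation

/-! ### Criticality in the symmetric and in the full space. -/

section SymmetricCriticality

variable {d n : ℕ}

/-- Symmetric outer products of unit vectors, as elements of the space of symmetric tensors. -/
def symUnitOuterProducts (d n : ℕ) : Set (symTensors d n) :=
  Subtype.val ⁻¹' unitOuterProducts d n

theorem isCompact_symUnitOuterProducts : IsCompact (symUnitOuterProducts d n) :=
  (symTensors d n).closed_of_finiteDimensional.isClosedEmbedding_subtypeVal.isCompact_preimage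
    isCompact_unitOuterProducts

/-- The inequality is inherited from the full space; attainment is Banach's theorem. -/
theorem isSupportFunction_spectralNorm2_symTensors (hd : 1 ≤ d)
    (hn : (unitOuterProducts d n).Nonempty) :
    IsSupportFunction (symUnitOuterProducts d n)
      (fun B : symTensors d n => spectralNorm2 (B : RTensor d n)) where
  inner_le A X hX := (isSupportFunction_spectralNorm2 hn).inner_le A X hX
  exists_eq A := by
    obtain ⟨X, hX, hXs, hAX⟩ := exists_symm_inner_eq_spectralNorm2 hd hn A.2
    exact ⟨⟨X, hXs⟩, hX, hAX⟩

/-- The symmetric tensors among the maximizers defining the spectral norm of `A`. -/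
theorem image_exposedFace_symUnitOuterProducts (A : symTensors d n) :
    (symTensors d n).subtype '' exposedFace (symUnitOuterProducts d n)
      (fun B : symTensors d n => spectralNorm2 (B : RTensor d n)) A =
    {X | X ∈ symTensors d n ∧ X ∈ exposedFace (unitOuterProducts d n) spectralNorm2 A} := by
  ext X
  constructor
  · rintro ⟨X, hX, rfl⟩
    exact ⟨X.2, hX⟩
  · rintro ⟨hXs, hX⟩
    exact ⟨⟨X, hXs⟩, hX, rfl⟩

/-- The inclusion is linear and injective, so the hull condition transfers to the full space, where
it can be compared with `isCriticalTensor_iff`. -/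
theorem isCriticalSymTensor_iff (hd : 1 ≤ d) {A : symTensors d n} (hA : A ≠ 0) :
    IsCriticalSymTensor A ↔
      (spectralNorm2 (A : RTensor d n) / ‖(A : RTensor d n)‖ ^ 2) • (A : RTensor d n) ∈
        convexHull ℝ {X | X ∈ symTensors d n ∧
          X ∈ exposedFace (unitOuterProducts d n) spectralNorm2 (A : RTensor d n)} := by
  have hA' : (A : RTensor d n) ≠ 0 := fun h => hA (Subtype.ext h)
  have hf := isSupportFunction_spectralNorm2_symTensors hd (unitOuterProducts_nonempty hA')
  rw [IsCriticalSymTensor, and_iff_right hA,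
    hf.isCriticalOnUnitSphere_normalize_iff isCompact_symUnitOuterProducts hA,
    ← image_exposedFace_symUnitOuterProducts, ← LinearMap.image_convexHull]
  exact ((symTensors d n).injective_subtype.mem_set_image (a := (_ : ℝ) • A)).symm

theorem isCriticalTensor_iff {A : RTensor d n} (hA : A ≠ 0) :
    IsCriticalTensor A ↔ (spectralNorm2 A / ‖A‖ ^ 2) • A ∈
      convexHull ℝ (exposedFace (unitOuterProducts d n) spectralNorm2 A) := by
  rw [IsCriticalTensor, and_iff_right hA]
  exact (isSupportFunction_spectralNorm2
    (unitOuterProducts_nonempty hA)).isCriticalOnUnitSphere_normalize_iff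
      isCompact_unitOuterProducts hA

open scoped Pointwise in
theorem setOf_symm_isBestRankOneApprox (hd : 1 ≤ d) {A : RTensor d n} (hA : A ≠ 0) :
    {Y : RTensor d n | Y ∈ symTensors d n ∧ IsBestRankOneApprox A Y} =
      spectralNorm2 A • {X | X ∈ symTensors d n ∧
        X ∈ exposedFace (unitOuterProducts d n) spectralNorm2 A} := by
  have hpos := spectralNorm2_pos hd hA
  ext Y
  simp only [Set.mem_smul_set, Set.mem_ofPred_eq, isBestRankOneApprox_iff hd hA]
  constructor
  · rintro ⟨hY, X, hX, rfl⟩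
    exact ⟨X, ⟨((symTensors d n).smul_mem_iff hpos.ne').1 hY, hX⟩, rfl⟩
  · rintro ⟨X, ⟨hXs, hX⟩, rfl⟩
    exact ⟨(symTensors d n).smul_mem _ hXs, X, hX, rfl⟩

end SymmetricCriticality

theorem mainTheorem5 (d n : ℕ) (hd : 1 ≤ d) (A : symTensors d n) (hA : A ≠ 0) :
    (IsCriticalSymTensor A ↔
      (spectralNorm2 (A : RTensor d n) ^ 2 / ‖(A : RTensor d n)‖ ^ 2) • (A : RTensor d n) ∈
        convexHull ℝ {Y : RTensor d n |
          Y ∈ symTensors d n ∧ IsBestRankOneApprox (A : RTensor d n) Y}) ∧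
    (IsCriticalSymTensor A → IsCriticalTensor (A : RTensor d n)) := by
  have hA' : (A : RTensor d n) ≠ 0 := fun h => hA (Subtype.ext h)
  rw [isCriticalSymTensor_iff hd hA, isCriticalTensor_iff hA']
  refine ⟨?_, fun h => convexHull_mono (fun X hX => hX.2) h⟩
  -- One of the two factors `spectralNorm2 A` cancels against the scaling of the hull.
  rw [setOf_symm_isBestRankOneApprox hd hA', convexHull_smul, pow_two (spectralNorm2 _),
    mul_div_assoc, mul_smul, Set.smul_mem_smul_set_iff₀ (spectralNorm2_pos hd hA').ne']
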